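/- Let $\alpha$ be a variable. For a non-empty finite word $u$, let $u^R$ denote its mirror image. Let $p\in\{\alpha,\alpha^R\}^+$ be a unary pattern with reversals, and let $|p|$ be its length. An instance of $p$ is a word obtained from $p$ by choosing a non-empty finite word $u$ and replacing every $\alpha$ by $u$ and every $\alpha^R$ by $u^R$. A finite or infinite word (infinite words being indexed by $\mathbb{N}$) meets $p$ if some finite factor of it is an instance of $p$, and otherwise it avoids $p$. For $k\ge 1$, the pattern $p$ is $k$-avoidable if infinitely many finite words over a $k$-letter alphabet avoid $p$, and $k$-unavoidable if every long enough finite word over a $k$-letter alphabet meets $p$; $p$ is unavoidable if it is $k$-unavoidable for every $k\ge 1$. An infinite word is aperiodic if it is not of the form $uv^\omega$ with $u,v$ finite words and $v$ non-empty. Then: 1. $p$ is unavoidable if and only if $p\in\{\alpha,\alpha^R\}$, that is, if and only if $|p|=1$. 2. If $|p|>1$, there exists an infinite aperiodic word over a ternary (three-letter) alphabet that avoids $p$. 3. If $p$ has $\alpha\alpha^R$ or $\alpha^R\alpha$ as a factor, then $p$ is $2$-avoidable; moreover, the infinite word $(01)^\omega$ avoids $p$. 4. If $|p|>2$, there exists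 an infinite aperiodic word over a binary (two-letter) alphabet that avoids $p$. -/

import Mathlib

/-- A symbol of a pattern with reversals over the set of variables `E`:
a variable `α`, or its reversal `α^R`. -/
inductive PatternSymbol (E : Type*) where
  | var (a : E) : PatternSymbol E
  | rev (a : E) : PatternSymbol E

/-- Patterns with reversals over `E`: finite words over the symbols `α`, `α^R` for `α` in `E`. -/
abbrev RevPattern (E : Type*) := List (PatternSymbol E)

/-- The image of a symbol when the variables are replaced by words according to `φ`:
`α` becomes `φ α`, and `α^R` becomes the mirror image of `φ α`. -/
def PatternSymbol.image {E A : Type*} (φ : E → List A) : PatternSymbol E → List A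
  | .var a => φ a
  | .rev a => (φ a).reverse

/-- The pattern language of `p` over the alphabet `A`: all images of `p` under assignments of
non-empty words to the variables. -/
def patternLanguage {E : Type*} (A : Type*) (p : RevPattern E) : Set (List A) :=
  {u | ∃ φ : E → List A, (∀ a, φ a ≠ []) ∧ u = p.flatMap (PatternSymbol.image φ)}

/-- The finite word `w` meets `p`: some factor of `w` lies in the pattern language of `p`. -/
def Meets {E A : Type*} (w : List A) (p : RevPattern E) : Prop :=
  ∃ u ∈ patternLanguage A p, u <:+: w

/-- The finite word `w` avoids `p`. -/
def Avoids {E A : Type*} (w : List A) (p : RevPattern E) : Prop := ¬ Meets w p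

/-- The infinite word `w` meets `p`: some finite factor of `w`, starting at a position `i` and of
a length `n`, lies in the pattern language of `p`. -/
def InfMeets {E A : Type*} (w : Stream' A) (p : RevPattern E) : Prop :=
  ∃ i n : ℕ, (w.drop i).take n ∈ patternLanguage A p

/-- The infinite word `w` avoids `p`. -/
def InfAvoids {E A : Type*} (w : Stream' A) (p : RevPattern E) : Prop := ¬ InfMeets w p

/-- `p` is `k`-avoidable: infinitely many finite words over a `k`-letter alphabet avoid `p`. -/
def IsAvoidableOver {E : Type*} (k : ℕ) (p : RevPattern E) : Prop :=
  {w : List (Fin k) | Avoids w p}.Infinite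

/-- `p` is `k`-unavoidable: every long enough word over a `k`-letter alphabet meets `p`. -/
def IsUnavoidableOver {E : Type*} (k : ℕ) (p : RevPattern E) : Prop :=
  ∃ N : ℕ, ∀ w : List (Fin k), N ≤ w.length → Meets w p

/-- `p` is unavoidable: it is `k`-unavoidable for every `k ≥ 1` (alphabets are non-empty). -/
def IsUnavoidable {E : Type*} (p : RevPattern E) : Prop :=
  ∀ k : ℕ, 1 ≤ k → IsUnavoidableOver k p

/-- An infinite word is aperiodic if it is not ultimately periodic, that is, not of the form
`u v^ω` with finite words `u` and `v`, where `v` is non-empty. -/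
def IsAperiodicWord {A : Type*} (w : Stream' A) : Prop :=
  ¬ ∃ (u v : List A) (hv : v ≠ []), w = u ++ₛ Stream'.cycle v hv

/-- Unary patterns with reversals: words over `{α, α^R}` for a single variable `α`. -/
abbrev UnaryPattern := RevPattern Unit

/-- The single variable `α`. -/
abbrev symA : PatternSymbol Unit := .var ()

/-- The reversal `α^R` of the single variable. -/
abbrev symAR : PatternSymbol Unit := .rev ()

/-!
Two adjacent blocks of an instance of a unary pattern, of common length `q`, form a square if the two
symbols are equal and an even palindrome `x x^R` if they differ. Hence only the first two or three
symbols of the pattern matter, and infinite words are needed that exclude certain combinations of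
squares and even palindromes.

* An even palindrome contains the square of its central letter. Thus the square-free ternary
  Thue–Morse word avoids every pattern of length at least two
  (`ternaryThueMorse_not_squareAt`), and `(01)^ω`, in which consecutive letters differ, avoids every
  pattern with two different adjacent symbols.
* Over two letters, `x x x` is excluded by the Thue–Morse word, which is overlap-free
  (`thueMorse_overlap_free`).
* The pattern `x x^R x` has two palindromic centres at distance `|x|`, with another `|x|` letters in
  front of the first one. It is excluded by an alternating word whose alternation breaks exactly at
  the powers of two (`logWord_not_mirrorAt`), since the gaps between breaks increase.
* The patterns `x x x^R` and `x x^R x^R` are excluded by the word of the parities of `⌊n φ²⌋`, where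
  `φ` is the golden ratio and `ψ` its conjugate. A square of period `q` in this word forces the
  fractional parts of `q` consecutive multiples of `φ²` to avoid an interval whose length is the
  distance of `q φ²` to an even integer. With `F_k` denoting the Fibonacci numbers, any `F_{j+2}`
  consecutive multiples meet the intervals `[0, |ψ|^j)` and `[1 - |ψ|^j, 1)`
  (`exists_fract_mul_goldenRatio_sq`), and this leaves only the periods `q = F_k` with `F_{k+2}`
  even (`eq_fib_of_goldenFloor_period`). The adjacent palindrome then provides positions
  at distances `F_{k+1}` and `F_{k+2}` from a third one, all three carrying the same letter. As
  `F_{k+3}` and `F_{k+4}` are odd, both translations would have to cross an integer, although they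
  go in opposite directions with total length at most one (`floor_sub_goldenConj_pow`).
-/

/-! ### Occurrences of unary patterns in infinite words -/

/-- The word `w` has a square `xx` with `|x| = q` at position `i`. -/
def SquareAt {A : Type*} (w : Stream' A) (i q : ℕ) : Prop :=
  ∀ j < q, w.get (i + j) = w.get (i + q + j)

/-- The word `w` has an even palindrome `x x^R` with `|x| = q` at position `i`. -/
def MirrorAt {A : Type*} (w : Stream' A) (i q : ℕ) : Prop :=
  ∀ j < q, w.get (i + j) = w.get (i + q + (q - 1 - j))

/-- The instance of the pattern `p` obtained from the word `U 0 ⋯ U (q - 1)` occurs in `w` at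
position `i`. -/
def OccursAt {A : Type*} (w : Stream' A) (q : ℕ) (U : ℕ → A) : UnaryPattern → ℕ → Prop
  | [], _ => True
  | .var _ :: p, i => (∀ j < q, w.get (i + j) = U j) ∧ OccursAt w q U p (i + q)
  | .rev _ :: p, i => (∀ j < q, w.get (i + j) = U (q - 1 - j)) ∧ OccursAt w q U p (i + q)

theorem occursAt_of_getElem? {A : Type*} {w : Stream' A} {φ : Unit → List A} {U : ℕ → A}
    (hU : ∀ j < (φ ()).length, (φ ())[j]? = some (U j)) (p : UnaryPattern) (i : ℕ)
    (h : ∀ j a, (p.flatMap (PatternSymbol.image φ))[j]? = some a → w.get (i + j) = a) :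
    OccursAt w (φ ()).length U p i := by
  induction p generalizing i with
  | nil => trivial
  | cons s p ih =>
    have hlen : (PatternSymbol.image φ s).length = (φ ()).length := by
      cases s <;> simp [PatternSymbol.image]
    have hrest : OccursAt w (φ ()).length U p (i + (φ ()).length) := by
      refine ih _ fun j a hj => ?_
      rw [add_assoc]
      refine h _ a ?_
      rw [List.flatMap_cons, List.getElem?_append_right (by omega), hlen, Nat.add_sub_cancel_left]
      exact hj
    have hfirst : ∀ j < (φ ()).length, ∀ a, (PatternSymbol.image φ s)[j]? = some a →
        w.get (i + j) = a := by
      intro j hj a ha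
      refine h j a ?_
      rw [List.flatMap_cons, List.getElem?_append_left (by omega), ha]
    cases s with
    | var a => exact ⟨fun j hj => hfirst j hj _ (hU j hj), hrest⟩
    | rev a =>
      refine ⟨fun j hj => hfirst j hj _ ?_, hrest⟩
      rw [PatternSymbol.image, List.getElem?_reverse hj]
      exact hU _ (by omega)

theorem InfMeets.exists_occursAt {A : Type*} {w : Stream' A} {p : UnaryPattern}
    (h : InfMeets w p) : ∃ i q U, 0 < q ∧ OccursAt w q U p i := by
  obtain ⟨i, n, φ, hφ, h⟩ := h
  refine ⟨i, (φ ()).length, fun j => (φ ()).getD j (w.get 0), List.length_pos_iff.2 (hφ ()),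
    occursAt_of_getElem? (fun j hj => by simp [hj]) p i fun j a hj => ?_⟩
  rw [← h] at hj
  have hjn : j < n := by
    by_contra hjn
    rw [List.getElem?_eq_none (by simpa using hjn)] at hj
    simp at hj
  rw [Stream'.getElem?_take hjn, Stream'.get_drop] at hj
  exact Option.some.inj hj

theorem OccursAt.of_append {A : Type*} {w : Stream' A} {q : ℕ} {U : ℕ → A}
    (s : UnaryPattern) {p : UnaryPattern} {i : ℕ} (h : OccursAt w q U (s ++ p) i) :
    ∃ i', OccursAt w q U p i' := by
  induction s generalizing i with
  | nil => exact ⟨i, h⟩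
  | cons a s ih => cases a <;> exact ih h.2

theorem OccursAt.tail {A : Type*} {w : Stream' A} {q : ℕ} {U : ℕ → A} {s : PatternSymbol Unit}
    {p : UnaryPattern} {i : ℕ} (h : OccursAt w q U (s :: p) i) : OccursAt w q U p (i + q) := by
  cases s <;> exact h.2

theorem OccursAt.squareAt {A : Type*} {w : Stream' A} {q : ℕ} {U : ℕ → A}
    {s : PatternSymbol Unit} {p : UnaryPattern} {i : ℕ}
    (h : OccursAt w q U (s :: s :: p) i) : SquareAt w i q := by
  intro j hj
  cases s <;> rw [h.1 j hj, h.2.1 j hj]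

theorem OccursAt.mirrorAt {A : Type*} {w : Stream' A} {q : ℕ} {U : ℕ → A}
    {s t : PatternSymbol Unit} (hst : s ≠ t) {p : UnaryPattern} {i : ℕ}
    (h : OccursAt w q U (s :: t :: p) i) : MirrorAt w i q := by
  intro j hj
  have hj' : q - 1 - j < q := by omega
  have hjj : q - 1 - (q - 1 - j) = j := by omega
  cases s <;> cases t
  · exact absurd rfl hst
  · rw [h.1 j hj, h.2.1 _ hj', hjj]
  · rw [h.1 j hj, h.2.1 _ hj']
  · exact absurd rfl hst

/-- The two letters at the centre of an even palindrome agree. -/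
theorem MirrorAt.get_eq_get {A : Type*} {w : Stream' A} {i q : ℕ} (hq : 0 < q)
    (h : MirrorAt w i q) : w.get (i + q - 1) = w.get (i + q) := by
  have := h (q - 1) (by omega)
  rwa [show i + (q - 1) = i + q - 1 by omega, show i + q + (q - 1 - (q - 1)) = i + q by omega]
    at this

theorem IsAperiodicWord.of_get_ne {A : Type*} {w : Stream' A}
    (h : ∀ N q, 0 < q → ∃ n, N ≤ n ∧ w.get (n + q) ≠ w.get n) : IsAperiodicWord w := by
  rintro ⟨u, v, hv, rfl⟩
  obtain ⟨n, hn, hne⟩ := h u.length v.length (List.length_pos_iff.2 hv)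
  obtain ⟨m, rfl⟩ := Nat.exists_eq_add_of_le hn
  rw [add_assoc, Stream'.get_append_right, Stream'.get_append_right, add_comm m] at hne
  nth_rw 1 [Stream'.cycle_eq] at hne
  rw [Stream'.get_append_right] at hne
  exact hne rfl

/-- A word without squares has no period from any point on. -/
theorem IsAperiodicWord.of_not_squareAt {A : Type*} {w : Stream' A}
    (h : ∀ i q, 0 < q → ¬ SquareAt w i q) : IsAperiodicWord w := by
  refine .of_get_ne fun N q hq => ?_
  by_contra! H
  refine h N q hq fun j _ => ?_
  rw [add_right_comm, H _ (by omega)]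

/-- A word without cubes has no period from any point on. -/
theorem IsAperiodicWord.of_not_cube {A : Type*} {w : Stream' A}
    (h : ∀ i q, 0 < q → SquareAt w i q → ¬ SquareAt w (i + q) q) : IsAperiodicWord w := by
  refine .of_get_ne fun N q hq => ?_
  by_contra! H
  refine h N q hq (fun j _ => ?_) fun j _ => ?_
  · rw [add_right_comm, H _ (by omega)]
  · rw [add_right_comm (N + q), H _ (by omega)]

theorem InfAvoids.avoids_take {E A : Type*} {w : Stream' A} {p : RevPattern E}
    (h : InfAvoids w p) (n : ℕ) : Avoids (w.take n) p := by
  rintro ⟨u, hu, s, t, hst⟩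
  refine h ⟨s.length, u.length, ?_⟩
  have hlen : s.length + u.length + t.length = n := by
    simpa [add_assoc] using congrArg List.length hst
  have htake : (w.drop s.length).take u.length = u := by
    rw [Stream'.take_drop]
    have : w.take (s.length + u.length) = (w.take n).take (s.length + u.length) := by
      rw [Stream'.take_take]; congr 1; omega
    rw [this, ← hst, ← List.length_append, List.take_left, List.drop_left]
  rwa [htake]

theorem InfAvoids.isAvoidableOver {E : Type*} {k : ℕ} {w : Stream' (Fin k)} {p : RevPattern E}
    (h : InfAvoids w p) : IsAvoidableOver k p := by
  refine Set.infinite_of_injective_forall_mem (f := fun n => w.take n) (fun m n hmn => ?_)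
    fun n => h.avoids_take n
  simpa using congrArg List.length hmn

theorem InfAvoids.not_isUnavoidableOver {E : Type*} {k : ℕ} {w : Stream' (Fin k)}
    {p : RevPattern E} (h : InfAvoids w p) : ¬ IsUnavoidableOver k p := by
  rintro ⟨N, hN⟩
  exact h.avoids_take N (hN _ (by simp))

theorem isUnavoidable_singleton (s : PatternSymbol Unit) : IsUnavoidable [s] := by
  refine fun k _ => ⟨1, fun w hw => ?_⟩
  obtain ⟨a, w, rfl⟩ := List.exists_cons_of_length_pos hw
  refine ⟨[a], ⟨fun _ => [a], by simp, ?_⟩, [], w, by simp⟩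
  cases s <;> simp [PatternSymbol.image]

/-- If the infinite word `w` avoids squares, it avoids every unary pattern of length at least two:
an even palindrome contains the square of its central letter. -/
theorem InfAvoids.of_not_squareAt {A : Type*} {w : Stream' A}
    (h : ∀ i q, 0 < q → ¬ SquareAt w i q) {p : UnaryPattern} (hp : 1 < p.length) :
    InfAvoids w p := by
  intro hw
  obtain ⟨i, q, U, hq, ho⟩ := hw.exists_occursAt
  match p, hp with
  | s :: t :: r, _ =>
    by_cases hst : s = t
    · subst hst
      exact h i q hq ho.squareAt
    · refine h (i + q - 1) 1 one_pos fun j hj => ?_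
      obtain rfl : j = 0 := by omega
      have := (ho.mirrorAt hst).get_eq_get hq
      rwa [show i + q - 1 + 1 + 0 = i + q by omega]

theorem get_cycle_zero_one (n : ℕ) :
    (Stream'.cycle [(0 : Fin 2), 1] (List.cons_ne_nil _ _)).get n ≠
      (Stream'.cycle [(0 : Fin 2), 1] (List.cons_ne_nil _ _)).get (n + 1) := by
  induction n using Nat.twoStepInduction with
  | zero =>
    rw [Stream'.cycle_eq]
    exact Fin.zero_ne_one
  | one =>
    rw [Stream'.cycle_eq, Stream'.cycle_eq]
    exact Fin.zero_ne_one.symm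
  | more n ih _ =>
    rw [Stream'.cycle_eq]
    exact ih

/-- The word `(01)^ω` has no two equal consecutive letters, hence no even palindromes. -/
theorem infAvoids_cycle_zero_one {s t : PatternSymbol Unit} (hst : s ≠ t) {p : UnaryPattern}
    (hp : [s, t] <:+: p) :
    InfAvoids (Stream'.cycle [(0 : Fin 2), 1] (List.cons_ne_nil _ _)) p := by
  intro hw
  obtain ⟨i, q, U, hq, ho⟩ := hw.exists_occursAt
  obtain ⟨a, b, rfl⟩ := hp
  rw [List.append_assoc] at ho
  obtain ⟨i, ho⟩ := ho.of_append
  refine get_cycle_zero_one (i + q - 1) ?_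
  rw [show i + q - 1 + 1 = i + q by omega]
  exact (ho.mirrorAt hst).get_eq_get hq

/-! ### The Thue–Morse word -/

/-- The Thue–Morse sequence: the parity of the binary digit sum of `n`. -/
def thueMorse (n : ℕ) : ℕ := (Nat.digits 2 n).sum % 2

theorem thueMorse_lt_two (n : ℕ) : thueMorse n < 2 := Nat.mod_lt _ two_pos

theorem thueMorse_two_mul (n : ℕ) : thueMorse (2 * n) = thueMorse n := by
  rcases Nat.eq_zero_or_pos n with rfl | hn
  · rfl
  · have := Nat.digits_add 2 one_lt_two 0 n two_pos (Or.inr hn.ne')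
    simp only [zero_add] at this
    simp [thueMorse, this]

theorem thueMorse_two_mul_add_one (n : ℕ) : thueMorse (2 * n + 1) = 1 - thueMorse n := by
  have := Nat.digits_add 2 one_lt_two 1 n one_lt_two (Or.inl one_ne_zero)
  simp only [thueMorse, add_comm (2 * n), this, List.sum_cons]
  omega

theorem not_thueMorse_eq_eq (n : ℕ) :
    ¬ (thueMorse n = thueMorse (n + 1) ∧ thueMorse (n + 1) = thueMorse (n + 2)) := by
  rintro ⟨h₁, h₂⟩
  obtain ⟨a, rfl | rfl⟩ := n.even_or_odd'
  · rw [thueMorse_two_mul_add_one, thueMorse_two_mul] at h₁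
    have := thueMorse_lt_two a
    omega
  · rw [show 2 * a + 1 + 1 = 2 * (a + 1) by ring, show 2 * a + 1 + 2 = 2 * (a + 1) + 1 by ring,
      thueMorse_two_mul_add_one, thueMorse_two_mul] at h₂
    have := thueMorse_lt_two (a + 1)
    omega

/-- If each of two consecutive pairs of letters starting at odd positions consists of different
letters, then halving the positions yields three equal consecutive letters. -/
theorem not_thueMorse_odd_ne_odd_ne (b : ℕ) :
    ¬ (thueMorse (2 * b + 1) ≠ thueMorse (2 * b + 2) ∧
      thueMorse (2 * b + 3) ≠ thueMorse (2 * b + 4)) := by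
  rintro ⟨h₁, h₂⟩
  rw [show 2 * b + 2 = 2 * (b + 1) by ring, thueMorse_two_mul_add_one, thueMorse_two_mul] at h₁
  rw [show 2 * b + 3 = 2 * (b + 1) + 1 by ring, show 2 * b + 4 = 2 * (b + 2) by ring,
    thueMorse_two_mul_add_one, thueMorse_two_mul] at h₂
  have := thueMorse_lt_two b
  have := thueMorse_lt_two (b + 1)
  have := thueMorse_lt_two (b + 2)
  exact not_thueMorse_eq_eq b ⟨by omega, by omega⟩

theorem thueMorse_even_ne (b : ℕ) : thueMorse (2 * b) ≠ thueMorse (2 * b + 1) := by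
  rw [thueMorse_two_mul_add_one, thueMorse_two_mul]
  have := thueMorse_lt_two b
  omega

/-- The Thue–Morse word is overlap-free. -/
theorem thueMorse_overlap_free (q : ℕ) (hq : 0 < q) (i : ℕ) :
    ¬ ∀ j ≤ q, thueMorse (i + j) = thueMorse (i + q + j) := by
  induction q using Nat.strong_induction_on generalizing i with
  | _ q ih =>
  intro h
  obtain ⟨r, rfl | rfl⟩ := q.even_or_odd'
  · -- An overlap with even period restricts to an overlap at the positions of one parity.
    obtain ⟨a, rfl | rfl⟩ := i.even_or_odd'
    · refine ih r (by omega) (by omega) a fun j hj => ?_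
      have := h (2 * j) (by omega)
      rwa [← mul_add, ← mul_add, ← mul_add, thueMorse_two_mul, thueMorse_two_mul] at this
    · refine ih r (by omega) (by omega) a fun j hj => ?_
      have := h (2 * j) (by omega)
      rw [show 2 * a + 1 + 2 * j = 2 * (a + j) + 1 by ring,
        show 2 * a + 1 + 2 * r + 2 * j = 2 * (a + r + j) + 1 by ring,
        thueMorse_two_mul_add_one, thueMorse_two_mul_add_one] at this
      have := thueMorse_lt_two (a + j)
      have := thueMorse_lt_two (a + r + j)
      omega
  · rcases Nat.eq_zero_or_pos r with rfl | hr
    · exact not_thueMorse_eq_eq i ⟨h 0 (by omega), h 1 (by omega)⟩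
    · -- An odd period matches pairs starting at even positions with pairs starting at odd ones.
      have h0 := h 0 (by omega)
      have h1 := h 1 (by omega)
      have h2 := h 2 (by omega)
      have h3 := h 3 (by omega)
      obtain ⟨a, rfl | rfl⟩ := i.even_or_odd'
      · refine not_thueMorse_odd_ne_odd_ne (a + r) ⟨?_, ?_⟩
        · have := thueMorse_even_ne a
          rw [show 2 * (a + r) + 1 = 2 * a + (2 * r + 1) + 0 by ring,
            show 2 * (a + r) + 2 = 2 * a + (2 * r + 1) + 1 by ring, ← h0, ← h1]
          exact this
        · have := thueMorse_even_ne (a + 1)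
          rw [show 2 * (a + r) + 3 = 2 * a + (2 * r + 1) + 2 by ring,
            show 2 * (a + r) + 4 = 2 * a + (2 * r + 1) + 3 by ring, ← h2, ← h3]
          exact this
      · refine not_thueMorse_odd_ne_odd_ne a ⟨?_, ?_⟩
        · have := thueMorse_even_ne (a + r + 1)
          rw [show 2 * a + 1 = 2 * a + 1 + 0 by ring, show 2 * a + 2 = 2 * a + 1 + 1 by ring,
            h0, h1]
          convert this using 2 <;> ring
        · have := thueMorse_even_ne (a + r + 2)
          rw [show 2 * a + 3 = 2 * a + 1 + 2 by ring, show 2 * a + 4 = 2 * a + 1 + 3 by ring,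
            h2, h3]
          convert this using 2 <;> ring

/-- The Thue–Morse word over `{0, 1}`. -/
def thueMorseWord : Stream' (Fin 2) := fun n => ⟨thueMorse n, thueMorse_lt_two n⟩

theorem thueMorseWord_get_eq {m n : ℕ} :
    thueMorseWord.get m = thueMorseWord.get n ↔ thueMorse m = thueMorse n :=
  Fin.mk.injEq .. ▸ Iff.rfl

theorem thueMorseWord_not_cube (i q : ℕ) (hq : 0 < q) (h₁ : SquareAt thueMorseWord i q) :
    ¬ SquareAt thueMorseWord (i + q) q := by
  intro h₂
  refine thueMorse_overlap_free q hq i fun j hj => ?_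
  rcases hj.lt_or_eq with hj | rfl
  · exact thueMorseWord_get_eq.1 (h₁ j hj)
  · exact thueMorseWord_get_eq.1 (h₂ 0 hq)

/-- The ternary Thue–Morse word: the differences of consecutive letters of the Thue–Morse word,
shifted by one in order to lie in `{0, 1, 2}`. -/
def ternaryThueMorse : Stream' (Fin 3) := fun n =>
  ⟨thueMorse (n + 1) + 1 - thueMorse n, by have := thueMorse_lt_two (n + 1); omega⟩

theorem ternaryThueMorse_get_eq {m n : ℕ} :
    ternaryThueMorse.get m = ternaryThueMorse.get n ↔
      thueMorse (m + 1) + thueMorse n = thueMorse (n + 1) + thueMorse m := by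
  have := thueMorse_lt_two m
  have := thueMorse_lt_two n
  unfold ternaryThueMorse Stream'.get
  rw [Fin.mk.injEq]
  omega

/-- The ternary Thue–Morse word is square-free. The differences over a square `xx` sum to
`2 * ∑ x`, which must lie in `{-1, 0, 1}`; hence `∑ x = 0`, and the Thue–Morse word repeats itself
over `x`, which yields an overlap. -/
theorem ternaryThueMorse_not_squareAt (i q : ℕ) (hq : 0 < q) :
    ¬ SquareAt ternaryThueMorse i q := by
  intro h
  have key : ∀ j ≤ q, thueMorse (i + j) + thueMorse (i + q) =
      thueMorse i + thueMorse (i + q + j) := by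
    intro j
    induction j with
    | zero => intro _; simp
    | succ j ih =>
      intro hj
      have h₁ := ih (by omega)
      have h₂ := ternaryThueMorse_get_eq.1 (h j (by omega))
      simp only [← add_assoc]
      omega
  have hlast := key q le_rfl
  have := thueMorse_lt_two i
  have := thueMorse_lt_two (i + q)
  have := thueMorse_lt_two (i + q + q)
  refine thueMorse_overlap_free q hq i fun j hj => ?_
  have := key j hj
  omega

/-! ### Words of parities -/

/-- The binary word whose `n`-th letter is the parity of `f n`. -/
def parityWord (f : ℕ → ℤ) : Stream' (Fin 2) := fun n => if Even (f n) then 0 else 1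

theorem parityWord_get_eq {f : ℕ → ℤ} {m n : ℕ} :
    (parityWord f).get m = (parityWord f).get n ↔ (Even (f m) ↔ Even (f n)) := by
  unfold parityWord Stream'.get
  beta_reduce
  by_cases hm : Even (f m) <;> by_cases hn : Even (f n) <;> simp only [hm, hn, if_true, if_false] <;>
    simp

/-! ### A word whose even palindromes have centres at growing distances -/

/-- The binary word of the parities of `n + ⌊log₂ n⌋` for `n ≥ 1`: it alternates, except that
the letters for `n - 1` and `n` agree when `n ≥ 2` is a power of two. -/
def logWord : Stream' (Fin 2) := parityWord fun n => ((n + 1 + Nat.log 2 (n + 1) : ℕ) : ℤ)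

theorem logWord_get_eq {m n : ℕ} : logWord.get m = logWord.get n ↔
    (m + 1 + Nat.log 2 (m + 1)) % 2 = (n + 1 + Nat.log 2 (n + 1)) % 2 := by
  rw [logWord, parityWord_get_eq, Int.even_coe_nat, Int.even_coe_nat, Nat.even_iff, Nat.even_iff]
  omega

theorem eq_two_pow_of_logWord_get_eq {n : ℕ} (hn : 0 < n)
    (h : logWord.get (n - 1) = logWord.get n) : n + 1 = 2 ^ Nat.log 2 (n + 1) := by
  rw [logWord_get_eq, Nat.sub_add_cancel hn] at h
  have hle : 2 ^ Nat.log 2 (n + 1) ≤ n + 1 := Nat.pow_log_le_self 2 (by omega)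
  by_contra hne
  have : Nat.log 2 n = Nat.log 2 (n + 1) :=
    Nat.log_eq_of_pow_le_of_lt_pow (by omega)
      (lt_trans (Nat.lt_succ_self n) (Nat.lt_pow_succ_log_self one_lt_two _))
  omega

/-- The equal letters at the centres of `x x^R` and `x^R x` locate two powers of two at distance
`q = |x|`; the first power of two is thus at most `q`, which leaves no room for the first `x`. -/
theorem logWord_not_mirrorAt (i q : ℕ) (hq : 0 < q) (h₁ : MirrorAt logWord i q) :
    ¬ MirrorAt logWord (i + q) q := by
  intro h₂
  have e₁ := eq_two_pow_of_logWord_get_eq (by omega) (h₁.get_eq_get hq)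
  have e₂ := eq_two_pow_of_logWord_get_eq (by omega) (h₂.get_eq_get hq)
  have hlt : Nat.log 2 (i + q + 1) < Nat.log 2 (i + q + q + 1) := by
    rw [← Nat.pow_lt_pow_iff_right one_lt_two, ← e₁, ← e₂]
    omega
  have := Nat.pow_le_pow_right two_pos (Nat.succ_le_of_lt hlt)
  rw [← e₂, pow_succ, ← e₁] at this
  omega

theorem logWord_isAperiodicWord : IsAperiodicWord logWord := by
  refine .of_get_ne fun N q hq => ?_
  have hk : N + q + 1 < 2 ^ (N + q + 1) := Nat.lt_two_pow_self
  have hk' : 2 ^ (N + q + 1 + 1) = 2 * 2 ^ (N + q + 1) := by ring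
  have hk'' : 2 ^ (N + q + 1 + 2) = 4 * 2 ^ (N + q + 1) := by ring
  rcases Nat.mod_two_eq_zero_or_one q with hq2 | hq2
  · -- An even shift from below a power of two onto it changes the logarithm by one.
    refine ⟨2 ^ (N + q + 1 + 1) - q - 1, by omega, ?_⟩
    rw [Ne, logWord_get_eq, show 2 ^ (N + q + 1 + 1) - q - 1 + q + 1 = 2 ^ (N + q + 1 + 1) by omega,
      Nat.log_pow one_lt_two,
      Nat.log_eq_of_pow_le_of_lt_pow (m := N + q + 1) (n := 2 ^ (N + q + 1 + 1) - q - 1 + 1)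
        (by omega) (by omega)]
    omega
  · -- An odd shift between two powers of two does not change the logarithm.
    refine ⟨2 ^ (N + q + 1) - 1, by omega, ?_⟩
    rw [Ne, logWord_get_eq,
      Nat.log_eq_of_pow_le_of_lt_pow (m := N + q + 1) (n := 2 ^ (N + q + 1) - 1 + 1)
        (by omega) (by omega),
      Nat.log_eq_of_pow_le_of_lt_pow (m := N + q + 1) (n := 2 ^ (N + q + 1) - 1 + q + 1)
        (by omega) (by omega)]
    omega

/-! ### Fibonacci rotations -/

section Golden

open scoped goldenRatio

theorem floor_add_eq_or_floor_sub_eq (y : ℝ) {s t : ℝ} (hs : 0 ≤ s) (ht : 0 ≤ t)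
    (hst : s + t ≤ 1) : ⌊y + s⌋ = ⌊y⌋ ∨ ⌊y - t⌋ = ⌊y⌋ := by
  have h₀ := Int.floor_le y
  have h₁ := Int.lt_floor_add_one y
  rcases lt_or_ge (y + s) (⌊y⌋ + 1) with h | h
  · exact Or.inl (Int.floor_eq_iff.2 ⟨by linarith, h⟩)
  · exact Or.inr (Int.floor_eq_iff.2 ⟨by linarith, by linarith⟩)

/-- If a finite set of points on the circle `ℝ / ℤ` is mapped into itself by a map that advances
each point by a positive amount of at most `c`, then some point lies in `[0, c)` and some point
lies in `[1 - c, 1)`. -/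
theorem exists_fract_of_advance {W : Finset ℤ} (hW : W.Nonempty) {x : ℤ → ℝ} {T : ℤ → ℤ} {c : ℝ}
    (hc : c ≤ 1) (hT : ∀ n ∈ W, T n ∈ W)
    (hx : ∀ n ∈ W, ∃ m : ℤ, 0 < x (T n) - x n - m ∧ x (T n) - x n - m ≤ c) :
    (∃ n ∈ W, Int.fract (x n) < c) ∧ ∃ n ∈ W, 1 - c ≤ Int.fract (x n) := by
  obtain ⟨n, hn, hmax⟩ := W.exists_max_image (fun n => Int.fract (x n)) hW
  obtain ⟨m, hm₀, hm₁⟩ := hx n hn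
  have h₀ := Int.fract_nonneg (x n)
  have h₁ := Int.fract_lt_one (x n)
  have hf := Int.floor_add_fract (x n)
  -- The point of largest fractional part has to wrap around.
  have hwrap : 1 ≤ Int.fract (x n) + (x (T n) - x n - m) := by
    by_contra! hlt
    have : Int.fract (x (T n)) = Int.fract (x n) + (x (T n) - x n - m) :=
      Int.fract_eq_iff.2 ⟨by linarith, hlt, ⌊x n⌋ + m, by push_cast; linarith⟩
    have := hmax _ (hT n hn)
    linarith
  have : Int.fract (x (T n)) = Int.fract (x n) + (x (T n) - x n - m) - 1 :=
    Int.fract_eq_iff.2 ⟨by linarith, by linarith, ⌊x n⌋ + m + 1, by push_cast; linarith⟩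
  exact ⟨⟨T n, hT n hn, by linarith⟩, n, hn, by linarith⟩

/-- The counterpart of `exists_fract_of_advance` for a map that moves each point backwards. -/
theorem exists_fract_of_retreat {W : Finset ℤ} (hW : W.Nonempty) {x : ℤ → ℝ} {T : ℤ → ℤ} {c : ℝ}
    (hc : c ≤ 1) (hT : ∀ n ∈ W, T n ∈ W)
    (hx : ∀ n ∈ W, ∃ m : ℤ, 0 < x n + m - x (T n) ∧ x n + m - x (T n) ≤ c) :
    (∃ n ∈ W, Int.fract (x n) < c) ∧ ∃ n ∈ W, 1 - c ≤ Int.fract (x n) := by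
  obtain ⟨n, hn, hmin⟩ := W.exists_min_image (fun n => Int.fract (x n)) hW
  obtain ⟨m, hm₀, hm₁⟩ := hx n hn
  have h₀ := Int.fract_nonneg (x n)
  have h₁ := Int.fract_lt_one (x n)
  have hf := Int.floor_add_fract (x n)
  have hwrap : Int.fract (x n) < x n + m - x (T n) := by
    by_contra! hle
    have : Int.fract (x (T n)) = Int.fract (x n) - (x n + m - x (T n)) :=
      Int.fract_eq_iff.2 ⟨by linarith, by linarith, ⌊x n⌋ + m, by push_cast; linarith⟩
    have := hmin _ (hT n hn)
    linarith
  have : Int.fract (x (T n)) = Int.fract (x n) - (x n + m - x (T n)) + 1 :=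
    Int.fract_eq_iff.2 ⟨by linarith, by linarith, ⌊x n⌋ + m - 1, by push_cast; linarith⟩
  exact ⟨⟨n, hn, by linarith⟩, T n, hT n hn, by linarith⟩

theorem fib_mul_goldenRatio_sq (j : ℕ) : (Nat.fib j : ℝ) * φ ^ 2 = Nat.fib (j + 2) - ψ ^ j := by
  have := Real.fib_succ_sub_goldenRatio_mul_fib j
  rw [Real.goldenRatio_sq, Nat.fib_add_two]
  push_cast
  linarith

theorem neg_goldenConj_pos : 0 < -ψ := neg_pos.2 Real.goldenConj_neg

theorem neg_goldenConj_lt_one : -ψ < 1 := by linarith [Real.neg_one_lt_goldenConj]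

/-- Among any `fib (j + 2)` consecutive multiples of `φ ^ 2` there is one whose fractional part lies
in `[0, |ψ| ^ j)` and one whose fractional part lies in `[1 - |ψ| ^ j, 1)`. Indeed exchanging
the two parts of the window, by the steps `fib (j + 1)` and `-fib j`, moves all multiples
in the same direction on the circle, by `|ψ| ^ (j + 1)` or `|ψ| ^ j`. -/
theorem exists_fract_mul_goldenRatio_sq (j : ℕ) (N : ℤ) :
    (∃ n ∈ Finset.Ico N (N + Nat.fib (j + 2)), Int.fract ((n : ℝ) * φ ^ 2) < (-ψ) ^ j) ∧
      ∃ n ∈ Finset.Ico N (N + Nat.fib (j + 2)),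
        1 - (-ψ) ^ j ≤ Int.fract ((n : ℝ) * φ ^ 2) := by
  have hpos : 0 < Nat.fib (j + 2) := Nat.fib_pos.2 (by omega)
  have hfib : Nat.fib (j + 2) = Nat.fib j + Nat.fib (j + 1) := Nat.fib_add_two
  have hW : (Finset.Ico N (N + Nat.fib (j + 2))).Nonempty := ⟨N, by rw [Finset.mem_Ico]; omega⟩
  have hc : (-ψ) ^ j ≤ 1 := pow_le_one₀ neg_goldenConj_pos.le neg_goldenConj_lt_one.le
  have hc₀ : 0 < (-ψ) ^ j := pow_pos neg_goldenConj_pos j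
  have hc₁ : 0 < (-ψ) ^ (j + 1) := pow_pos neg_goldenConj_pos _
  have hc₂ : (-ψ) ^ (j + 1) ≤ (-ψ) ^ j :=
    pow_le_pow_of_le_one neg_goldenConj_pos.le neg_goldenConj_lt_one.le j.le_succ
  have e₀ := fib_mul_goldenRatio_sq j
  have e₁ := fib_mul_goldenRatio_sq (j + 1)
  let T : ℤ → ℤ := fun n => if n < N + Nat.fib j then n + Nat.fib (j + 1) else n - Nat.fib j
  have hT : ∀ n ∈ Finset.Ico N (N + Nat.fib (j + 2)), T n ∈ Finset.Ico N (N + Nat.fib (j + 2)) := by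
    intro n hn
    simp only [Finset.mem_Ico, T] at hn ⊢
    split_ifs <;> omega
  rcases Nat.even_or_odd j with hj | hj
  · refine exists_fract_of_advance (T := T) hW hc hT fun n _ => ?_
    rw [hj.neg_pow] at hc₀ hc₂ ⊢
    rw [hj.add_one.neg_pow] at hc₁ hc₂
    simp only [T]
    split_ifs
    · refine ⟨Nat.fib (j + 1 + 2), ?_⟩
      push_cast
      rw [add_mul, e₁]
      constructor <;> linarith
    · refine ⟨-Nat.fib (j + 2), ?_⟩
      push_cast
      rw [sub_mul, e₀]
      constructor <;> linarith
  · refine exists_fract_of_retreat (T := T) hW hc hT fun n _ => ?_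
    rw [hj.neg_pow] at hc₀ hc₂ ⊢
    rw [hj.add_one.neg_pow] at hc₁ hc₂
    simp only [T]
    split_ifs
    · refine ⟨Nat.fib (j + 1 + 2), ?_⟩
      push_cast
      rw [add_mul, e₁]
      constructor <;> linarith
    · refine ⟨-Nat.fib (j + 2), ?_⟩
      push_cast
      rw [sub_mul, e₀]
      constructor <;> linarith

/-- Two consecutive pairs of Fibonacci numbers form a basis of `ℤ × ℤ`. -/
theorem exists_eq_mul_fib_add_mul_fib (k : ℕ) (q e : ℤ) : ∃ a b : ℤ,
    q = a * Nat.fib (k + 1) + b * Nat.fib k ∧ e = a * Nat.fib (k + 2) + b * Nat.fib (k + 1) := by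
  induction k with
  | zero => exact ⟨q, e - q, by simp, by simp⟩
  | succ k ih =>
    obtain ⟨a, b, hq, he⟩ := ih
    refine ⟨b, a - b, ?_, ?_⟩
    · rw [hq, Nat.fib_add_two (n := k)]
      push_cast
      ring
    · rw [he, Nat.fib_add_two (n := k + 1)]
      push_cast
      ring

/-! ### The parities of `⌊n φ²⌋` -/

/-- The sequence `⌊n φ ^ 2⌋` over all integers `n`; for `n ≥ 1` it is the upper Wythoff sequence. -/
noncomputable def goldenFloor (n : ℤ) : ℤ := ⌊(n : ℝ) * φ ^ 2⌋

/-- If the parity of `⌊n φ ^ 2⌋` has period `q` over at least `fib (j + 2)` consecutive `n`, then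
`q φ ^ 2` is within `|ψ| ^ j` of an even integer: otherwise a multiple of `φ ^ 2` with small
fractional part, or one with large fractional part, breaks the period. -/
theorem exists_even_abs_sub_lt {N : ℤ} {q j : ℕ} (hj : Nat.fib (j + 2) ≤ q)
    (h : ∀ n, N ≤ n → n < N + q → (Even (goldenFloor (n + q)) ↔ Even (goldenFloor n))) :
    ∃ E : ℤ, Even E ∧ |(q : ℝ) * φ ^ 2 - E| < (-ψ) ^ j := by
  obtain ⟨⟨n₁, hn₁, h₁⟩, n₂, hn₂, h₂⟩ := exists_fract_mul_goldenRatio_sq j N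
  rw [Finset.mem_Ico] at hn₁ hn₂
  have hf := Int.floor_add_fract ((q : ℝ) * φ ^ 2)
  have hf₀ := Int.fract_nonneg ((q : ℝ) * φ ^ 2)
  have hf₁ := Int.fract_lt_one ((q : ℝ) * φ ^ 2)
  rcases Int.even_or_odd ⌊(q : ℝ) * φ ^ 2⌋ with hE | hE
  · refine ⟨_, hE, ?_⟩
    rw [abs_of_nonneg (by linarith)]
    by_contra! hlt
    have hf' := Int.floor_add_fract ((n₂ : ℝ) * φ ^ 2)
    have hlt' := Int.fract_lt_one ((n₂ : ℝ) * φ ^ 2)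
    have hfl : goldenFloor (n₂ + q) = goldenFloor n₂ + ⌊(q : ℝ) * φ ^ 2⌋ + 1 := by
      rw [goldenFloor, goldenFloor, Int.floor_eq_iff]
      push_cast
      constructor <;> linarith
    have := h n₂ hn₂.1 (by omega)
    rw [hfl, Int.even_add_one, Int.even_add] at this
    tauto
  · refine ⟨_, hE.add_one, ?_⟩
    push_cast
    rw [abs_of_nonpos (by linarith)]
    by_contra! hlt
    have hf' := Int.floor_add_fract ((n₁ : ℝ) * φ ^ 2)
    have hge' := Int.fract_nonneg ((n₁ : ℝ) * φ ^ 2)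
    have hfl : goldenFloor (n₁ + q) = goldenFloor n₁ + ⌊(q : ℝ) * φ ^ 2⌋ := by
      rw [goldenFloor, goldenFloor, Int.floor_eq_iff]
      push_cast
      constructor <;> linarith
    have := h n₁ hn₁.1 (by omega)
    rw [hfl, Int.even_add] at this
    rw [← Int.not_even_iff_odd] at hE
    tauto

/-- The squares in the word of the parities of `⌊n φ ^ 2⌋` have Fibonacci periods `fib k`
with `fib (k + 2)` even: by `exists_even_abs_sub_lt` the multiple `q φ ^ 2` is extremely close
to an even integer, and expressing both in the Fibonacci basis leaves no other choice. -/
theorem eq_fib_of_goldenFloor_period {N : ℤ} {q : ℕ} (hq : 0 < q)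
    (h : ∀ n, N ≤ n → n < N + q → (Even (goldenFloor (n + q)) ↔ Even (goldenFloor n))) :
    ∃ k, 0 < k ∧ q = Nat.fib k ∧ Even (Nat.fib (k + 2)) := by
  obtain ⟨j, hj⟩ : ∃ j, Nat.greatestFib q = j + 2 :=
    Nat.exists_eq_add_of_le' (Nat.le_greatestFib.2 hq)
  have hle : Nat.fib (j + 2) ≤ q := hj ▸ Nat.fib_greatestFib_le q
  have hlt : q < Nat.fib (j + 3) := by
    have := Nat.lt_fib_greatestFib_add_one q
    rwa [hj] at this
  obtain ⟨E, hE, hA⟩ := exists_even_abs_sub_lt hle h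
  obtain ⟨a, b, hqab, heab⟩ := exists_eq_mul_fib_add_mul_fib (j + 1) q (E - q)
  have hEab : E = a * Nat.fib (j + 4) + b * Nat.fib (j + 3) := by
    have h₄ : Nat.fib (j + 4) = Nat.fib (j + 2) + Nat.fib (j + 3) := Nat.fib_add_two
    have h₃ : Nat.fib (j + 3) = Nat.fib (j + 1) + Nat.fib (j + 2) := Nat.fib_add_two
    rw [h₄, h₃]
    rw [show j + 1 + 2 = j + 3 by ring, h₃] at heab
    push_cast at heab ⊢
    linear_combination heab + hqab
  have hpos : 0 < (-ψ) ^ j := pow_pos neg_goldenConj_pos j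
  -- In the Fibonacci basis the approximation says that `a ψ² + b ψ` lies in `(-1, 1)`.
  have hab : |(a : ℝ) * ψ ^ 2 + b * ψ| < 1 := by
    have e : (q : ℝ) * φ ^ 2 - E = -(ψ ^ j * (a * ψ ^ 2 + b * ψ)) := by
      have hqR : (q : ℝ) = a * Nat.fib (j + 2) + b * Nat.fib (j + 1) := by exact_mod_cast hqab
      rw [hqR, hEab]
      push_cast
      linear_combination (a : ℝ) * fib_mul_goldenRatio_sq (j + 2) +
        (b : ℝ) * fib_mul_goldenRatio_sq (j + 1)
    rw [e, abs_neg, abs_mul, abs_pow, abs_of_neg Real.goldenConj_neg] at hA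
    exact (mul_lt_iff_lt_one_right hpos).1 hA
  rw [Real.goldenConj_sq, abs_lt] at hab
  have hψ₀ := Real.goldenConj_neg
  have hψ₁ := Real.neg_one_lt_goldenConj
  have hψ₂ : ψ < -(1 / 2) := by nlinarith [Real.goldenConj_sq]
  have hy : (1 : ℤ) ≤ Nat.fib (j + 1) := by exact_mod_cast Nat.fib_pos.2 (by omega)
  have hyx : (Nat.fib (j + 1) : ℤ) ≤ Nat.fib (j + 2) := by exact_mod_cast Nat.fib_le_fib_succ
  have hle' : (Nat.fib (j + 2) : ℤ) ≤ q := by exact_mod_cast hle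
  have hlt' : (q : ℤ) < Nat.fib (j + 1) + Nat.fib (j + 2) := by
    rw [show j + 3 = j + 1 + 2 by ring, Nat.fib_add_two] at hlt
    exact_mod_cast hlt
  rw [show j + 1 + 1 = j + 2 by ring] at hqab
  rcases lt_trichotomy b 0 with hb | rfl | hb
  · have ha : 2 ≤ a := by
      by_contra! ha
      nlinarith
    have haR : (2 : ℝ) ≤ a := by exact_mod_cast ha
    have hbR : (b : ℝ) ≤ -1 := by exact_mod_cast Int.le_sub_one_of_lt hb
    nlinarith
  · have ha₁ : 0 < a := by
      by_contra! ha
      nlinarith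
    have ha₂ : a < 2 := by
      by_contra! ha
      nlinarith
    obtain rfl : a = 1 := by omega
    refine ⟨j + 2, by omega, by simpa using hqab, ?_⟩
    rw [hEab] at hE
    simpa [Int.even_coe_nat] using hE
  · have ha : a ≤ 0 := by
      by_contra! ha
      nlinarith
    have haR : (a : ℝ) ≤ 0 := by exact_mod_cast ha
    have hb₁ : b < 2 := by
      by_contra! hb₂
      have hbR : (2 : ℝ) ≤ b := by exact_mod_cast hb₂
      nlinarith
    obtain rfl : b = 1 := by omega
    have ha₀ : -1 < a := by
      by_contra! ha₁
      have haR : (a : ℝ) ≤ -1 := by exact_mod_cast ha₁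
      push_cast at hab
      nlinarith
    obtain rfl : a = 0 := by omega
    refine ⟨j + 1, by omega, by simpa using hqab, ?_⟩
    rw [hEab] at hE
    simpa [Int.even_coe_nat] using hE

/-- Translations by `-ψ ^ j` and `-ψ ^ (j + 1)` have opposite directions and total length at most
one, so that at most one of them crosses an integer. -/
theorem floor_sub_goldenConj_pow {j : ℕ} (hj : 0 < j) (y : ℝ) :
    (⌊y - ψ ^ j⌋ = ⌊y⌋ ∨ ⌊y - ψ ^ (j + 1)⌋ = ⌊y⌋) ∧
      (⌊y + ψ ^ j⌋ = ⌊y⌋ ∨ ⌊y + ψ ^ (j + 1)⌋ = ⌊y⌋) := by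
  have hsum : (-ψ) ^ (j + 1) + (-ψ) ^ j ≤ 1 := by
    have h₁ : (-ψ) ^ j ≤ (-ψ) ^ 1 :=
      pow_le_pow_of_le_one neg_goldenConj_pos.le neg_goldenConj_lt_one.le hj
    have h₂ : (-ψ) ^ (j + 1) ≤ (-ψ) ^ 2 :=
      pow_le_pow_of_le_one neg_goldenConj_pos.le neg_goldenConj_lt_one.le (by omega)
    rw [neg_sq, Real.goldenConj_sq] at h₂
    linarith
  have p₀ := (pow_pos neg_goldenConj_pos j).le
  have p₁ := (pow_pos neg_goldenConj_pos (j + 1)).le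
  rcases Nat.even_or_odd j with hj | hj
  · rw [hj.neg_pow] at p₀ hsum
    rw [hj.add_one.neg_pow] at p₁ hsum
    refine ⟨(floor_add_eq_or_floor_sub_eq y p₁ p₀ hsum).symm, ?_⟩
    have := floor_add_eq_or_floor_sub_eq y p₀ p₁ (by linarith)
    rwa [sub_neg_eq_add] at this
  · rw [hj.neg_pow] at p₀ hsum
    rw [hj.add_one.neg_pow] at p₁ hsum
    refine ⟨floor_add_eq_or_floor_sub_eq y p₀ p₁ (by linarith), ?_⟩
    have := floor_add_eq_or_floor_sub_eq y p₁ p₀ hsum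
    rw [sub_neg_eq_add] at this
    exact this.symm

/-- The shifts by consecutive Fibonacci numbers `fib j` and `fib (j + 1)` cannot both preserve the
parity of `⌊n φ ^ 2⌋` when `fib (j + 2)` and `fib (j + 3)` are odd: both would have to cross
an integer. -/
theorem goldenFloor_add_fib {j : ℕ} (hj : 0 < j) (h₂ : ¬ Even (Nat.fib (j + 2)))
    (h₃ : ¬ Even (Nat.fib (j + 3))) {n : ℤ}
    (e₀ : Even (goldenFloor (n + Nat.fib j)) ↔ Even (goldenFloor n)) :
    ¬ (Even (goldenFloor (n + Nat.fib (j + 1))) ↔ Even (goldenFloor n)) := by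
  intro e₁
  have key : ∀ i, goldenFloor (n + Nat.fib i) = ⌊(n : ℝ) * φ ^ 2 - ψ ^ i⌋ + Nat.fib (i + 2) := by
    intro i
    rw [goldenFloor, ← Int.floor_add_natCast]
    congr 1
    push_cast
    rw [add_mul, fib_mul_goldenRatio_sq]
    ring
  rw [key, Int.even_add, Int.even_coe_nat, goldenFloor] at e₀ e₁
  rw [show j + 1 + 2 = j + 3 by ring] at e₁
  rcases (floor_sub_goldenConj_pow hj ((n : ℝ) * φ ^ 2)).1 with h | h
  · rw [h] at e₀
    tauto
  · rw [h] at e₁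
    tauto

/-- The counterpart of `goldenFloor_add_fib` for shifts to the left. -/
theorem goldenFloor_sub_fib {j : ℕ} (hj : 0 < j) (h₂ : ¬ Even (Nat.fib (j + 2)))
    (h₃ : ¬ Even (Nat.fib (j + 3))) {n : ℤ}
    (e₀ : Even (goldenFloor (n - Nat.fib j)) ↔ Even (goldenFloor n)) :
    ¬ (Even (goldenFloor (n - Nat.fib (j + 1))) ↔ Even (goldenFloor n)) := by
  intro e₁
  have key : ∀ i, goldenFloor (n - Nat.fib i) = ⌊(n : ℝ) * φ ^ 2 + ψ ^ i⌋ - Nat.fib (i + 2) := by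
    intro i
    rw [goldenFloor, ← Int.floor_sub_natCast]
    congr 1
    push_cast
    rw [sub_mul, fib_mul_goldenRatio_sq]
    ring
  rw [key, Int.even_sub, Int.even_coe_nat, goldenFloor] at e₀ e₁
  rw [show j + 1 + 2 = j + 3 by ring] at e₁
  rcases (floor_sub_goldenConj_pow hj ((n : ℝ) * φ ^ 2)).2 with h | h
  · rw [h] at e₀
    tauto
  · rw [h] at e₁
    tauto

/-- The binary word of the parities of `⌊n φ ^ 2⌋` for `n ≥ 0`. Whether two
consecutive letters agree or differ is dictated by the Fibonacci word. -/
noncomputable def goldenWord : Stream' (Fin 2) := parityWord fun n => goldenFloor n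

theorem goldenWord_get_eq {m n : ℕ} :
    goldenWord.get m = goldenWord.get n ↔ (Even (goldenFloor m) ↔ Even (goldenFloor n)) :=
  parityWord_get_eq

theorem SquareAt.eq_fib {i q : ℕ} (hq : 0 < q) (h : SquareAt goldenWord i q) :
    ∃ k, 0 < k ∧ q = Nat.fib k ∧ Even (Nat.fib (k + 2)) := by
  refine eq_fib_of_goldenFloor_period (N := i) hq fun n hn hnq => ?_
  obtain ⟨n, rfl⟩ := Int.eq_ofNat_of_zero_le (show 0 ≤ n by omega)
  have := h (n - i) (by omega)
  rw [goldenWord_get_eq, show i + (n - i) = n by omega, show i + q + (n - i) = n + q by omega]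
    at this
  push_cast at this
  exact this.symm

theorem not_even_fib_succ {k : ℕ} (h : Even (Nat.fib k)) : ¬ Even (Nat.fib (k + 1)) := by
  intro h'
  have := Nat.dvd_gcd h.two_dvd h'.two_dvd
  rw [(Nat.fib_coprime_fib_succ k).gcd_eq_one] at this
  omega

theorem not_even_fib_of_even_succ {k : ℕ} (h : Even (Nat.fib (k + 1))) : ¬ Even (Nat.fib k) :=
  fun h' => not_even_fib_succ h' h

/-- When `fib (k + 2)` is even, `fib (k + 1)` is odd, and two positions at that distance lying
symmetrically about the centre of a palindrome `x x^R` with `|x| = fib k` belong to it. -/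
theorem exists_fib_eq {k : ℕ} (hk : 0 < k) (h : Even (Nat.fib (k + 2))) :
    ∃ r, Nat.fib (k + 1) = 2 * r + 1 ∧ r < Nat.fib k := by
  have hodd := Nat.not_even_iff_odd.1 (not_even_fib_of_even_succ h)
  obtain ⟨r, hr⟩ := hodd
  refine ⟨r, hr, ?_⟩
  obtain ⟨k, rfl⟩ := Nat.exists_eq_succ_of_ne_zero hk.ne'
  have h₁ : Nat.fib (k + 2) = Nat.fib k + Nat.fib (k + 1) := Nat.fib_add_two
  have h₂ : Nat.fib k ≤ Nat.fib (k + 1) := Nat.fib_le_fib_succ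
  replace hr : Nat.fib (k + 2) = 2 * r + 1 := hr
  rw [Nat.succ_eq_add_one]
  omega

/-- The word `goldenWord` has no factor `x x x^R`. The length of `x` is some `fib k`, and the two
mirror positions at distance `fib (k + 1)` around the centre of `x x^R`, together with the
position `fib k` before them, violate `goldenFloor_sub_fib`. -/
theorem goldenWord_not_squareAt_mirrorAt (i q : ℕ) (hq : 0 < q) (h₁ : SquareAt goldenWord i q) :
    ¬ MirrorAt goldenWord (i + q) q := by
  intro h₂
  obtain ⟨k, hk, rfl, hev⟩ := h₁.eq_fib hq
  obtain ⟨r, hr, hrk⟩ := exists_fib_eq hk hev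
  have h₃ : Nat.fib (k + 3) = Nat.fib (k + 1) + Nat.fib (k + 2) := Nat.fib_add_two
  have hF : Nat.fib (k + 2) = Nat.fib k + Nat.fib (k + 1) := Nat.fib_add_two
  have o₃ := not_even_fib_succ hev
  have o₄ : ¬ Even (Nat.fib (k + 4)) := by
    rw [show Nat.fib (k + 4) = Nat.fib (k + 2) + Nat.fib (k + 3) from Nat.fib_add_two, Nat.even_add]
    tauto
  have e₁ := goldenWord_get_eq.1 (h₁ (Nat.fib k - 1 - r) (by omega))
  have e₂ := goldenWord_get_eq.1 (h₂ (Nat.fib k - 1 - r) (by omega))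
  set n := i + Nat.fib k + Nat.fib k + (Nat.fib k - 1 - (Nat.fib k - 1 - r)) with hn
  rw [show ((i + Nat.fib k + (Nat.fib k - 1 - r) : ℕ) : ℤ) = n - Nat.fib (k + 1) by omega] at e₁ e₂
  rw [show ((i + (Nat.fib k - 1 - r) : ℕ) : ℤ) = n - Nat.fib (k + 1 + 1) by
    rw [show k + 1 + 1 = k + 2 by ring]; omega] at e₁
  exact goldenFloor_sub_fib (by omega) o₃ o₄ e₂ (e₁.trans e₂)

/-- The word `goldenWord` has no factor `x x^R x^R`, by the mirror image of the argument for
`x x x^R`. -/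
theorem goldenWord_not_mirrorAt_squareAt (i q : ℕ) (hq : 0 < q) (h₁ : MirrorAt goldenWord i q) :
    ¬ SquareAt goldenWord (i + q) q := by
  intro h₂
  obtain ⟨k, hk, rfl, hev⟩ := h₂.eq_fib hq
  obtain ⟨r, hr, hrk⟩ := exists_fib_eq hk hev
  have hF : Nat.fib (k + 2) = Nat.fib k + Nat.fib (k + 1) := Nat.fib_add_two
  have o₃ := not_even_fib_succ hev
  have o₄ : ¬ Even (Nat.fib (k + 4)) := by
    rw [show Nat.fib (k + 4) = Nat.fib (k + 2) + Nat.fib (k + 3) from Nat.fib_add_two, Nat.even_add]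
    tauto
  have e₁ := goldenWord_get_eq.1 (h₁ (Nat.fib k - 1 - r) (by omega))
  have e₂ := goldenWord_get_eq.1 (h₂ (Nat.fib k - 1 - (Nat.fib k - 1 - r)) (by omega))
  set n := i + (Nat.fib k - 1 - r) with hn
  rw [show ((i + Nat.fib k + (Nat.fib k - 1 - (Nat.fib k - 1 - r)) : ℕ) : ℤ) =
    n + Nat.fib (k + 1) by omega] at e₁ e₂
  rw [show ((i + Nat.fib k + Nat.fib k + (Nat.fib k - 1 - (Nat.fib k - 1 - r)) : ℕ) : ℤ) =
    n + Nat.fib (k + 1 + 1) by rw [show k + 1 + 1 = k + 2 by ring]; omega] at e₂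
  exact goldenFloor_add_fib (by omega) o₃ o₄ e₁.symm (e₂.symm.trans e₁.symm)

/-- A period `q` would make both `q` and `2 * q` periods of squares, hence Fibonacci numbers `fib k`
with `fib (k + 2)` even; this is impossible for the even number `2 * q`. -/
theorem goldenWord_isAperiodicWord : IsAperiodicWord goldenWord := by
  refine .of_get_ne fun N q hq => ?_
  by_contra! H
  have hsq : SquareAt goldenWord N (2 * q) := by
    intro j _
    rw [show N + 2 * q + j = N + j + q + q by ring, H _ (by omega), H _ (by omega)]
  obtain ⟨k, -, hqk, hev⟩ := hsq.eq_fib (by omega)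
  rw [Nat.fib_add_two, Nat.even_add, ← hqk] at hev
  refine not_even_fib_succ (k := k) ?_ (hev.1 (even_two_mul q))
  rw [← hqk]
  exact even_two_mul q

end Golden

/-! ### Avoidability of unary patterns with reversals -/

/-- Three consecutive blocks of an instance of a pattern form two adjacent pairs, each of which is
a square or an even palindrome; for each of the four combinations a word is known that excludes it. -/
theorem exists_isAperiodicWord_infAvoids {p : UnaryPattern} (hp : 2 < p.length) :
    ∃ w : Stream' (Fin 2), IsAperiodicWord w ∧ InfAvoids w p := by
  match p, hp with
  | a :: b :: c :: p, _ =>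
    by_cases hab : a = b <;> by_cases hbc : b = c
    · subst hab hbc
      refine ⟨thueMorseWord, .of_not_cube thueMorseWord_not_cube, fun hw => ?_⟩
      obtain ⟨i, q, U, hq, ho⟩ := hw.exists_occursAt
      exact thueMorseWord_not_cube i q hq ho.squareAt ho.tail.squareAt
    · subst hab
      refine ⟨goldenWord, goldenWord_isAperiodicWord, fun hw => ?_⟩
      obtain ⟨i, q, U, hq, ho⟩ := hw.exists_occursAt
      exact goldenWord_not_squareAt_mirrorAt i q hq ho.squareAt (ho.tail.mirrorAt hbc)
    · subst hbc
      refine ⟨goldenWord, goldenWord_isAperiodicWord, fun hw => ?_⟩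
      obtain ⟨i, q, U, hq, ho⟩ := hw.exists_occursAt
      exact goldenWord_not_mirrorAt_squareAt i q hq (ho.mirrorAt hab) ho.tail.squareAt
    · refine ⟨logWord, logWord_isAperiodicWord, fun hw => ?_⟩
      obtain ⟨i, q, U, hq, ho⟩ := hw.exists_occursAt
      exact logWord_not_mirrorAt i q hq (ho.mirrorAt hab) (ho.tail.mirrorAt hbc)

theorem isUnavoidable_iff {p : UnaryPattern} (hp : p ≠ []) :
    IsUnavoidable p ↔ p = [symA] ∨ p = [symAR] := by
  constructor
  · intro h
    match p, hp with
    | [.var ()], _ => exact Or.inl rfl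
    | [.rev ()], _ => exact Or.inr rfl
    | s :: t :: p, _ =>
      exact absurd (h 3 (by norm_num)) (InfAvoids.of_not_squareAt ternaryThueMorse_not_squareAt
        (p := s :: t :: p) (by simp)).not_isUnavoidableOver
  · rintro (rfl | rfl) <;> exact isUnavoidable_singleton _

theorem mainTheorem2 (p : UnaryPattern) (hp : p ≠ []) :
    (IsUnavoidable p ↔ p = [symA] ∨ p = [symAR]) ∧
    (1 < p.length → ∃ w : Stream' (Fin 3), IsAperiodicWord w ∧ InfAvoids w p) ∧
    ([symA, symAR] <:+: p ∨ [symAR, symA] <:+: p →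
      IsAvoidableOver 2 p ∧
        InfAvoids (Stream'.cycle [(0 : Fin 2), 1] (List.cons_ne_nil _ _)) p) ∧
    (2 < p.length → ∃ w : Stream' (Fin 2), IsAperiodicWord w ∧ InfAvoids w p) := by
  refine ⟨isUnavoidable_iff hp, fun hp => ⟨ternaryThueMorse,
    .of_not_squareAt ternaryThueMorse_not_squareAt,
    .of_not_squareAt ternaryThueMorse_not_squareAt hp⟩, fun h => ?_,
    exists_isAperiodicWord_infAvoids⟩
  have hw : InfAvoids (Stream'.cycle [(0 : Fin 2), 1] (List.cons_ne_nil _ _)) p := by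
    rcases h with h | h
    · exact infAvoids_cycle_zero_one (by simp) h
    · exact infAvoids_cycle_zero_one (by simp) h
  exact ⟨hw.isAvoidableOver, hw⟩
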